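/- Markovian bandits. A Markovian bandit problem $M$ with $n$ arms of $S$ states each is given by transition probabilities $Q^a(x,y)$ and reward laws $\nu^a(x)$ on $[0,1]$ ($a\in[n]$, $x,y$ among the $S$ states of arm $a$). In a global state $\mathbf x=(x_1,\dots,x_n)$ one activates an arm $a$, receives a reward with law $\nu^a(x_a)$, and arm $a$ moves to $y$ with probability $Q^a(x_a,y)$, while the other arms do not move. For a deterministic policy $\pi$ (a map from global states to arms) let $V_M^\pi(\mathbf x)$ be the expected $\beta$-discounted total reward from $\mathbf x$, and let $\pi_*$ be an optimal policy. There are $K$ episodes; episode $k$ starts in a global state $\mathbf X^{(k)}$ of law $\rho$ and has an independent geometric length $H_k$ with $\mathbb P(H_k=h)=(1-\beta)\beta^{h-1}$, $h\ge1$. A learning algorithm $\mathcal L$ is a (measurable) map from the observations (states, arms, rewards) of all previous episodes to probability distributions on policies; $\pi_k$ is drawn from this distribution before episode $k$ and used throughout it. The Bayesian regret of $\mathcal L$ for a prior $\phi$ on Markovian bandit problems is $$\mathrm{BayReg}(K,\mathcal L,\phi)=\mathbb E\Big[\sum_{k=1}^K V_M^{\pi_*}(\mathbf X^{(k)})-V_M^{\pi_k}(\mathbf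 X^{(k)})\Big],$$ where the expectation is over $M\sim\phi$ and the runs of the algorithm. Theorem. Let $S\ge1$, $n\ge2$, $0\le\beta<1$ and $K\ge16S$. There are an initial distribution $\rho$ and a prior $\phi$ on Markovian bandit problems with $n$ arms of $S$ states each such that every learning algorithm $\mathcal L$ (which may depend on $\rho$, $\phi$ and all the parameters) satisfies $$\mathrm{BayReg}(K,\mathcal L,\phi)\ \ge\ \frac1{60}\min\left\{\sqrt{\frac{SnK}{1-\beta}},\ \frac{K}{1-\beta}\right\}.$$ In particular the Bayesian regret is at least $\frac1{60}\sqrt{SnK/(1-\beta)}$ whenever $Sn\le K/(1-\beta)$. -/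

import Mathlib

open MeasureTheory ProbabilityTheory
open scoped ENNReal

noncomputable section

/-- Global states of a Markovian bandit with `n` arms having `S` states each. -/
abbrev GlobalState (S n : ℕ) : Type := Fin n → Fin S

/-- Deterministic stationary policies: the arm to activate in each global state. -/
abbrev Policy (S n : ℕ) : Type := GlobalState S n → Fin n

/-- What is observed in one time step: global state, activated arm, reward. -/
abbrev Step (S n : ℕ) : Type := GlobalState S n × Fin n × ℝ

/-- The observations of one episode. `⟨h, e⟩` is an episode of length `H = h + 1 ≥ 1`. -/
abbrev Episode (S n : ℕ) : Type := Σ h : ℕ, Fin (h + 1) → Step S n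

/-- A Markovian bandit problem: arm `a` in state `x` gives, when activated, a reward with law
`rewardLaw a x` on `[0, 1]`, and moves to state `y` with probability `Q a x y`. -/
structure MarkovianBandit (S n : ℕ) where
  Q : Fin n → Fin S → Fin S → ℝ
  Q_nonneg : ∀ a x y, 0 ≤ Q a x y
  Q_sum : ∀ a x, ∑ y, Q a x y = 1
  rewardLaw : Fin n → Fin S → Measure ℝ
  rewardLaw_prob : ∀ a x, IsProbabilityMeasure (rewardLaw a x)
  rewardLaw_mem : ∀ a x, ∀ᵐ r ∂(rewardLaw a x), r ∈ Set.Icc (0 : ℝ) 1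

/-- The σ-algebra generated by the transition probabilities and the reward laws. -/
instance MarkovianBandit.instMeasurableSpace (S n : ℕ) : MeasurableSpace (MarkovianBandit S n) :=
  MeasurableSpace.comap (fun M => (M.Q, M.rewardLaw)) inferInstance

namespace MarkovianBandit

variable {S n : ℕ} (M : MarkovianBandit S n)

/-- Law of the next global state when arm `a` is activated in the global state `x`:
arm `a` moves according to `Q a`, the other arms do not move. -/
def transKernel : Kernel (GlobalState S n × Fin n) (GlobalState S n) :=
  Kernel.ofFunOfCountable fun p =>
    ∑ y : Fin S, ENNReal.ofReal (M.Q p.2 (p.1 p.2) y) • Measure.dirac (Function.update p.1 p.2 y)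

/-- Law of `(X_t, A_t, R_t)` given `X_t = x` when the policy `π` is used. -/
def stepKernel (π : Policy S n) : Kernel (GlobalState S n) (Step S n) :=
  Kernel.ofFunOfCountable fun x =>
    (M.rewardLaw (π x) (x (π x))).map fun r => (x, π x, r)

/-- Law of `(X_{t+1}, A_{t+1}, R_{t+1})` given `(X_t, A_t, R_t)` when the policy `π` is used. -/
def nextKernel (π : Policy S n) : Kernel (Step S n) (Step S n) :=
  M.stepKernel π ∘ₖ M.transKernel.comap (fun s => (s.1, s.2.1)) (by fun_prop)

/-- Law of the first `h + 1` steps under the policy `π`, as a function of the initial state. -/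
def trajKernel (π : Policy S n) : (h : ℕ) → Kernel (GlobalState S n) (Fin (h + 1) → Step S n)
  | 0 => (M.stepKernel π).map fun s _ => s
  | h + 1 =>
    (trajKernel π h ⊗ₖ (M.nextKernel π).comap
      (fun p : GlobalState S n × (Fin (h + 1) → Step S n) => p.2 (Fin.last h))
      (by fun_prop)).map fun p => Fin.snoc (α := fun _ => Step S n) p.1 p.2

/-- The value of the policy `π` from the initial state `x`: the expected discounted reward
`∑ t, β ^ t * 𝔼[R_t | X_0 = x]`. -/
def value (β : ℝ) (π : Policy S n) (x : GlobalState S n) : ℝ :=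
  ∑' t : ℕ, β ^ t * ∫ e, (e (Fin.last t)).2.2 ∂(M.trajKernel π t x)

/-- A policy is optimal if its value is maximal from every state. -/
def IsOptimal (β : ℝ) (π : Policy S n) : Prop :=
  ∀ (π' : Policy S n) (x : GlobalState S n), M.value β π' x ≤ M.value β π x

/-- The optimal value. -/
def optValue (β : ℝ) (x : GlobalState S n) : ℝ :=
  ⨆ π : Policy S n, M.value β π x

/-- The optimal value is the value of any optimal policy. -/
theorem optValue_eq_of_isOptimal {β : ℝ} {π : Policy S n} (h : M.IsOptimal β π)
    (x : GlobalState S n) : M.optValue β x = M.value β π x := by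
  have : Nonempty (Policy S n) := ⟨π⟩
  exact le_antisymm (ciSup_le fun π' => h π' x)
    (le_ciSup (f := fun π' => M.value β π' x) (Set.finite_range _).bddAbove π)

/-- Law of an episode as a function of the policy used: the initial state has law `ρ`, and the
length `H` is independent and geometric, `ℙ(H = h + 1) = (1 - β) * β ^ h`. -/
def episodeKernel (β : ℝ) (ρ : PMF (GlobalState S n)) : Kernel (Policy S n) (Episode S n) :=
  Kernel.ofFunOfCountable fun π =>
    Measure.sum fun h : ℕ => ENNReal.ofReal ((1 - β) * β ^ h) •
      ((M.trajKernel π h) ∘ₘ ρ.toMeasure).map (Sigma.mk h)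

end MarkovianBandit

/-- An episodic learning algorithm: a map from the observations made in the first `k` episodes
to a probability distribution over policies, from which the policy of the next episode is drawn. -/
structure LearningAlgorithm (S n : ℕ) where
  policyLaw : (k : ℕ) → Kernel (Fin k → Episode S n) (Policy S n)
  policyLaw_markov : ∀ k, IsMarkovKernel (policyLaw k)

namespace MarkovianBandit

variable {S n : ℕ} (M : MarkovianBandit S n)

/-- Joint law of the policy and the episode number `k + 1`, given the first `k` ones. The
algorithm uses the past only through the observations. -/
def roundKernel (β : ℝ) (ρ : PMF (GlobalState S n)) (L : LearningAlgorithm S n) (k : ℕ) :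
    Kernel (Fin k → Policy S n × Episode S n) (Policy S n × Episode S n) :=
  (L.policyLaw k).comap (fun w i => (w i).2) (by fun_prop) ⊗ₖ
    (M.episodeKernel β ρ).comap Prod.snd measurable_snd

/-- Law of the policies and episodes of the first `k` episodes. -/
def runLaw (β : ℝ) (ρ : PMF (GlobalState S n)) (L : LearningAlgorithm S n) :
    (k : ℕ) → Measure (Fin k → Policy S n × Episode S n)
  | 0 => Measure.dirac Fin.elim0
  | k + 1 => (runLaw β ρ L k ⊗ₘ M.roundKernel β ρ L k).map
      fun p => Fin.snoc (α := fun _ => Policy S n × Episode S n) p.1 p.2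

/-- The regret of a run of `K` episodes: the sum over the episodes of the optimal value minus the
value of the policy used, both at the initial state of the episode. -/
def regret (β : ℝ) {K : ℕ} (w : Fin K → Policy S n × Episode S n) : ℝ :=
  ∑ k, (M.optValue β ((w k).2.2 0).1 - M.value β (w k).1 ((w k).2.2 0).1)

/-- The expected regret over the runs of the algorithm. -/
def expectedRegret (β : ℝ) (ρ : PMF (GlobalState S n)) (L : LearningAlgorithm S n) (K : ℕ) : ℝ :=
  ∫ w, M.regret β w ∂(M.runLaw β ρ L K)

end MarkovianBandit

/-- The Bayesian regret for the prior `φ`. -/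
def bayesRegret {S n : ℕ} (β : ℝ) (ρ : PMF (GlobalState S n)) (φ : Measure (MarkovianBandit S n))
    (L : LearningAlgorithm S n) (K : ℕ) : ℝ :=
  ∫ M : MarkovianBandit S n, M.expectedRegret β ρ L K ∂φ

/-! All the laws above are probability measures. -/

namespace MarkovianBandit

variable {S n : ℕ} (M : MarkovianBandit S n)

instance : IsMarkovKernel M.transKernel := by
  refine ⟨fun p => ⟨?_⟩⟩
  simp only [transKernel, Kernel.ofFunOfCountable, Kernel.coe_mk, Measure.coe_finsetSum,
    Finset.sum_apply, Measure.smul_apply, measure_univ, smul_eq_mul, mul_one]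
  rw [← ENNReal.ofReal_sum_of_nonneg fun y _ => M.Q_nonneg _ _ y, M.Q_sum, ENNReal.ofReal_one]

instance (π : Policy S n) : IsMarkovKernel (M.stepKernel π) := by
  refine ⟨fun x => ?_⟩
  have := M.rewardLaw_prob (π x) (x (π x))
  exact Measure.isProbabilityMeasure_map (by fun_prop)

instance (π : Policy S n) : IsMarkovKernel (M.nextKernel π) := by
  unfold nextKernel; infer_instance

theorem measurable_snoc {α : Type*} [MeasurableSpace α] (k : ℕ) :
    Measurable fun p : (Fin k → α) × α => Fin.snoc (α := fun _ => α) p.1 p.2 := by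
  refine measurable_pi_lambda _ fun i => ?_
  refine Fin.lastCases ?_ (fun j => ?_) i
  · simpa using measurable_snd
  · simp only [Fin.snoc_castSucc]; fun_prop

instance (π : Policy S n) (h : ℕ) : IsMarkovKernel (M.trajKernel π h) := by
  induction h with
  | zero => exact Kernel.IsMarkovKernel.map _ (by fun_prop)
  | succ h ih => exact Kernel.IsMarkovKernel.map _ (measurable_snoc _)

theorem isMarkovKernel_episodeKernel {β : ℝ} (hβ0 : 0 ≤ β) (hβ1 : β < 1)
    (ρ : PMF (GlobalState S n)) : IsMarkovKernel (M.episodeKernel β ρ) := by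
  refine ⟨fun π => ⟨?_⟩⟩
  have hmap (h : ℕ) : (((M.trajKernel π h) ∘ₘ ρ.toMeasure).map
      (Sigma.mk (β := fun h : ℕ => Fin (h + 1) → Step S n) h)) Set.univ = 1 := by
    have hm : Measurable (Sigma.mk (β := fun h : ℕ => Fin (h + 1) → Step S n) h) := by
      exact fun s hs => MeasurableSpace.measurableSet_iInf.1 hs h
    rw [Measure.map_apply hm MeasurableSet.univ, Set.preimage_univ, measure_univ]
  simp only [episodeKernel, Kernel.ofFunOfCountable, Kernel.coe_mk,
    Measure.sum_apply _ MeasurableSet.univ, Measure.smul_apply, hmap, smul_eq_mul, mul_one]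
  have h0 : 0 < 1 - β := by linarith
  rw [← ENNReal.ofReal_tsum_of_nonneg (fun h => by positivity)
    ((summable_geometric_of_lt_one hβ0 hβ1).mul_left _), tsum_mul_left,
    tsum_geometric_of_lt_one hβ0 hβ1, mul_inv_cancel₀ h0.ne', ENNReal.ofReal_one]

theorem isProbabilityMeasure_runLaw {β : ℝ} (hβ0 : 0 ≤ β) (hβ1 : β < 1)
    (ρ : PMF (GlobalState S n)) (L : LearningAlgorithm S n) (k : ℕ) :
    IsProbabilityMeasure (M.runLaw β ρ L k) := by
  have := M.isMarkovKernel_episodeKernel hβ0 hβ1 ρ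
  induction k with
  | zero => unfold runLaw; infer_instance
  | succ k ih =>
    have := L.policyLaw_markov k
    have : IsMarkovKernel (M.roundKernel β ρ L k) := by unfold roundKernel; infer_instance
    exact Measure.isProbabilityMeasure_map (measurable_snoc _).aemeasurable

end MarkovianBandit

end

open MeasureTheory ProbabilityTheory
open scoped ENNReal

noncomputable section

/-! If the arms never move and the initial state is `(s, …, s)` with `s` uniform, then an episode
consists of pulls of a single arm in an `n`-armed bandit attached to `s`. The problem becomes `S`
such bandits, each receiving about `K / (S (1 - β))` pulls. The classical lower bound `√(n ·
pulls)`, summed over `s`, gives `√(S n K / (1 - β))`.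

The prior draws, independently for each `s`, a uniform arm `θ s` whose Bernoulli reward has mean
`1/2 + δ`; all other means are `1/2`. Fix `s` and erase the bonus at `s`. The resulting reference
model does not depend on `θ s`, so under it the learner picks `θ s` in state `s` with probability `1
/ n` on average over `θ s`. Restoring the bonus changes this probability by a constant factor
(`RelEntropyLE.integral_le`), plus a multiple of the relative entropy of the observations. By the
chain rule (`RelEntropyLE.compProd`) that entropy is bounded by order `δ²` times the expected number
of pulls of `θ s` under the reference model (`IsStatic.relEntropyLE_policyDist`), which averages to
`1 / n` of all pulls at `s`. With `δ² ≲ S n (1 - β) / K` the learner misses the best arm with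
probability bounded below in every episode (`sum_choiceProb_le`), and each miss costs `δ / (1 - β)`.

Relative entropy enters only through an inequality linear in both measures. Mixtures and images are
then immediate, and no densities are needed. -/

/-- The relative entropy of `μ` with respect to `ν` is at most `D`, in the linearized form of the
Donsker-Varadhan variational formula. -/
def RelEntropyLE {α : Type*} [MeasurableSpace α] (μ ν : Measure α) (D : ℝ) : Prop :=
  ∀ g : α → ℝ, Measurable g → (∃ C, ∀ x, |g x| ≤ C) →
    ∫ x, g x ∂μ ≤ D + ∫ x, Real.exp (g x) ∂ν - 1

/-! ### Calculus of relative entropy -/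

theorem integrable_of_abs_le {α : Type*} [MeasurableSpace α] (μ : Measure α) [IsFiniteMeasure μ]
    {g : α → ℝ} (hg : Measurable g) {C : ℝ} (hC : ∀ x, |g x| ≤ C) : Integrable g μ :=
  .of_bound hg.aestronglyMeasurable C (.of_forall hC)

theorem abs_exp_le_of_abs_le {x C : ℝ} (h : |x| ≤ C) : |Real.exp x| ≤ Real.exp C := by
  rw [Real.abs_exp]
  exact Real.exp_le_exp.2 ((le_abs_self x).trans h)

namespace RelEntropyLE

variable {α γ : Type*} [MeasurableSpace α] [MeasurableSpace γ] {μ ν : Measure α} {D D' : ℝ}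

theorem mono (h : RelEntropyLE μ ν D) (hD : D ≤ D') : RelEntropyLE μ ν D' :=
  fun g hg hC => (h g hg hC).trans (by linarith)

theorem refl (μ : Measure α) [IsProbabilityMeasure μ] : RelEntropyLE μ μ 0 := by
  rintro g hg ⟨C, hC⟩
  have h1 := integrable_of_abs_le μ hg hC
  have h2 := integrable_of_abs_le μ hg.exp fun x => abs_exp_le_of_abs_le (hC x)
  have : ∫ x, g x ∂μ ≤ ∫ x, (Real.exp (g x) - 1) ∂μ :=
    integral_mono h1 (h2.sub (integrable_const 1)) fun x => by
      have := Real.add_one_le_exp (g x)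
      simp only
      linarith
  rw [integral_sub h2 (integrable_const 1)] at this
  simpa using this

theorem map (h : RelEntropyLE μ ν D) {f : α → γ} (hf : Measurable f) :
    RelEntropyLE (μ.map f) (ν.map f) D := by
  rintro g hg ⟨C, hC⟩
  rw [integral_map hf.aemeasurable hg.aestronglyMeasurable,
    integral_map hf.aemeasurable hg.exp.aestronglyMeasurable]
  exact h (g ∘ f) (hg.comp hf) ⟨C, fun x => hC _⟩

theorem integral_exp_bounds [IsProbabilityMeasure ν] {g : α → ℝ} (hg : Measurable g) {C : ℝ}
    (hC : ∀ x, |g x| ≤ C) :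
    Real.exp (-C) ≤ ∫ x, Real.exp (g x) ∂ν ∧ ∫ x, Real.exp (g x) ∂ν ≤ Real.exp C := by
  have h2 := integrable_of_abs_le ν hg.exp fun x => abs_exp_le_of_abs_le (hC x)
  constructor
  · have := integral_mono (integrable_const (μ := ν) (Real.exp (-C))) h2
      fun x => Real.exp_le_exp.2 (abs_le.1 (hC x)).1
    simpa using this
  · have := integral_mono h2 (integrable_const (μ := ν) (Real.exp C))
      fun x => Real.exp_le_exp.2 (abs_le.1 (hC x)).2
    simpa using this

/-- The logarithmic form of the Donsker-Varadhan inequality. -/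
theorem integral_le_log [IsProbabilityMeasure μ] [IsProbabilityMeasure ν]
    (h : RelEntropyLE μ ν D) {g : α → ℝ} (hg : Measurable g) {C : ℝ} (hC : ∀ x, |g x| ≤ C) :
    ∫ x, g x ∂μ ≤ D + Real.log (∫ x, Real.exp (g x) ∂ν) := by
  set I := ∫ x, Real.exp (g x) ∂ν with hI
  have hpos : 0 < I := (Real.exp_pos _).trans_le (integral_exp_bounds hg hC).1
  -- This shift makes the exponential integral equal to 1, where `log t ≤ t - 1` is an equality.
  have := h (fun x => g x - Real.log I) (hg.sub_const _) ⟨C + |Real.log I|, fun x =>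
    (abs_sub _ _).trans (add_le_add_left (hC x) _)⟩
  rw [integral_sub (integrable_of_abs_le μ hg hC) (integrable_const _)] at this
  simp only [Real.exp_sub, Real.exp_log hpos, integral_div, ← hI, div_self hpos.ne',
    integral_const, probReal_univ, one_smul] at this
  linarith

/-- The chain rule. -/
theorem compProd [IsProbabilityMeasure μ] [IsProbabilityMeasure ν] {κ η : Kernel α γ}
    [IsMarkovKernel κ] [IsMarkovKernel η] (h : RelEntropyLE μ ν D) {d : α → ℝ}
    (hd : Integrable d μ) (hκ : ∀ᵐ x ∂μ, RelEntropyLE (κ x) (η x) (d x)) :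
    RelEntropyLE (μ ⊗ₘ κ) (ν ⊗ₘ η) (D + ∫ x, d x ∂μ) := by
  rintro g hg ⟨C, hC⟩
  have hgx (x : α) : Measurable fun y => g (x, y) := hg.comp measurable_prodMk_left
  have hexp : Measurable fun p : α × γ => Real.exp (g p) := hg.exp
  -- The logarithmic form on the fibre over `x` bounds the inner integral of `g` by `d x + G x`.
  -- Testing the hypothesis on `μ`, `ν` with `G` closes the argument, because `exp (G x)` is again
  -- the inner integral of `exp g`.
  set G : α → ℝ := fun x => Real.log (∫ y, Real.exp (g (x, y)) ∂(η x)) with hG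
  have hb (x : α) := integral_exp_bounds (ν := η x) (hgx x) fun y => hC (x, y)
  have hpos (x : α) := (Real.exp_pos _).trans_le (hb x).1
  have hGm : Measurable G :=
    (hexp.stronglyMeasurable.integral_kernel_prod_right' (κ := η)).measurable.log
  have hGC (x : α) : |G x| ≤ C := by
    rw [abs_le]
    exact ⟨(Real.le_log_iff_exp_le (hpos x)).2 (hb x).1,
      (Real.log_le_iff_le_exp (hpos x)).2 (hb x).2⟩
  have hGi := integrable_of_abs_le μ hGm hGC
  have hgi := integrable_of_abs_le (μ ⊗ₘ κ) hg hC
  have hei := integrable_of_abs_le (ν ⊗ₘ η) hexp fun x => abs_exp_le_of_abs_le (hC x)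
  rw [Measure.integral_compProd hgi, Measure.integral_compProd hei]
  have h1 : ∫ x, ∫ y, g (x, y) ∂(κ x) ∂μ ≤ ∫ x, (d x + G x) ∂μ := by
    refine integral_mono_ae ?_ (hd.add hGi) ?_
    · refine integrable_of_abs_le μ
        (hg.stronglyMeasurable.integral_kernel_prod_right' (κ := κ)).measurable (C := C) fun x => ?_
      simpa using norm_integral_le_of_norm_le_const (μ := κ x) (f := fun y => g (x, y))
        (.of_forall fun y => hC (x, y))
    · filter_upwards [hκ] with x hx
      exact hx.integral_le_log (hgx x) fun y => hC (x, y)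
  rw [integral_add hd hGi] at h1
  have h2 := h G hGm ⟨C, hGC⟩
  simp only [hG, Real.exp_log (hpos _)] at h2 h1
  linarith

/-- Joint convexity: the defining inequalities for one test function are averaged with the weights
`w i`, and the constant `-1` survives because the weights sum to 1. This handles the random episode
length. -/
theorem sum {μ ν : ℕ → Measure α} [∀ i, IsProbabilityMeasure (μ i)]
    [∀ i, IsProbabilityMeasure (ν i)] {w d : ℕ → ℝ} (hw : ∀ i, 0 ≤ w i) (hw1 : HasSum w 1)
    {D : ℝ} (hwd : HasSum (fun i => w i * d i) D) (h : ∀ i, RelEntropyLE (μ i) (ν i) (d i)) :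
    RelEntropyLE (Measure.sum fun i => ENNReal.ofReal (w i) • μ i)
      (Measure.sum fun i => ENNReal.ofReal (w i) • ν i) D := by
  rintro g hg ⟨C, hC⟩
  have hfin (μ : ℕ → Measure α) [∀ i, IsProbabilityMeasure (μ i)] :
      IsProbabilityMeasure (Measure.sum fun i => ENNReal.ofReal (w i) • μ i) := by
    refine ⟨?_⟩
    simp only [Measure.sum_apply _ MeasurableSet.univ, Measure.smul_apply, measure_univ,
      smul_eq_mul, mul_one]
    rw [← ENNReal.ofReal_tsum_of_nonneg hw hw1.summable, hw1.tsum_eq, ENNReal.ofReal_one]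
  have := hfin μ
  have := hfin ν
  have hs1 := hasSum_integral_measure (integrable_of_abs_le (Measure.sum fun i =>
    ENNReal.ofReal (w i) • μ i) hg hC)
  have hs2 := hasSum_integral_measure (integrable_of_abs_le (Measure.sum fun i =>
    ENNReal.ofReal (w i) • ν i) hg.exp fun x => abs_exp_le_of_abs_le (hC x))
  simp only [integral_smul_measure, ENNReal.toReal_ofReal (hw _), smul_eq_mul] at hs1 hs2
  refine hasSum_le (fun i => ?_) hs1 ((hwd.add hs2).sub hw1)
  have := mul_le_mul_of_nonneg_left (h i g hg ⟨C, hC⟩) (hw i)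
  linarith

/-- Change of measure for a function with values in `[0, 1]`. -/
theorem integral_le [IsProbabilityMeasure μ] [IsProbabilityMeasure ν] (h : RelEntropyLE μ ν D)
    {f : α → ℝ} (hf : Measurable f) (h0 : ∀ x, 0 ≤ f x) (h1 : ∀ x, f x ≤ 1) :
    ∫ x, f x ∂ν ≤ 2 * Real.log 2 * ∫ x, f x ∂μ + 2 * D := by
  have hlog : 0 ≤ Real.log 2 := Real.log_nonneg one_le_two
  have hb (x : α) : |f x| ≤ 1 := abs_le.2 ⟨by linarith [h0 x], h1 x⟩
  have hgb (x : α) : |-Real.log 2 * f x| ≤ Real.log 2 := by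
    rw [abs_mul, abs_neg, abs_of_nonneg hlog]
    exact mul_le_of_le_one_right hlog (hb x)
  have hg : Measurable fun x => -Real.log 2 * f x := hf.const_mul _
  -- On `[0, 1]` the chord of the convex function `exp (-t log 2)` is `1 - t / 2`, so this test
  -- function turns the exponential integral into `1 - (∫ f ∂ν) / 2`. The resulting factor `2 log 2`
  -- is below 2, which leaves room even for two arms.
  have key := h _ hg ⟨_, hgb⟩
  have hfi := integrable_of_abs_le ν hf hb
  have hle : ∫ x, Real.exp (-Real.log 2 * f x) ∂ν ≤ ∫ x, (1 - f x / 2) ∂ν := by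
    refine integral_mono (integrable_of_abs_le ν hg.exp fun x => abs_exp_le_of_abs_le (hgb x))
      ((integrable_const 1).sub (hfi.div_const 2)) fun x => ?_
    have := convexOn_exp.2 (Set.mem_univ 0) (Set.mem_univ (-Real.log 2))
      (sub_nonneg.2 (h1 x)) (h0 x) (by ring)
    simp only [smul_eq_mul, mul_zero, zero_add, Real.exp_zero, mul_one, Real.exp_neg,
      Real.exp_log two_pos] at this
    simp only
    rw [mul_comm]
    linarith
  rw [integral_sub (integrable_const 1) (hfi.div_const 2), integral_div] at hle
  rw [integral_const_mul] at key
  simp only [integral_const, probReal_univ, one_smul] at hle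
  linarith

end RelEntropyLE

/-! ### Measurability of episodes and of bandit problems -/

theorem measurable_sigma_mk {ι : Type*} {X : ι → Type*} [∀ i, MeasurableSpace (X i)] (i : ι) :
    Measurable (Sigma.mk (β := X) i) :=
  fun _ hs => MeasurableSpace.measurableSet_iInf.1 hs i

theorem measurable_of_sigma {ι γ : Type*} {X : ι → Type*} [∀ i, MeasurableSpace (X i)]
    [MeasurableSpace γ] {f : Sigma X → γ} (h : ∀ i, Measurable fun x => f ⟨i, x⟩) :
    Measurable f :=
  fun _ hs => MeasurableSpace.measurableSet_iInf.2 fun i => h i hs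

/-- A law on `ℝ` is determined by its values on rational half-lines, so a singleton is a countable
intersection of measurable sets. This allows integration of an arbitrary function of the problem
against a finite mixture of Dirac masses. -/
instance MarkovianBandit.instMeasurableSingletonClass (S n : ℕ) :
    MeasurableSingletonClass (MarkovianBandit S n) := by
  refine ⟨fun M => ?_⟩
  have hmeas : Measurable fun N : MarkovianBandit S n => (N.Q, N.rewardLaw) :=
    comap_measurable _
  have hset : ({M} : Set (MarkovianBandit S n)) = (fun N => N.Q) ⁻¹' {M.Q} ∩
      ⋂ (a : Fin n) (x : Fin S) (q : ℚ),
        (fun N => N.rewardLaw a x (Set.Iic (q : ℝ))) ⁻¹' {M.rewardLaw a x (Set.Iic (q : ℝ))} := by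
    ext N
    simp only [Set.mem_singleton_iff, Set.mem_inter_iff, Set.mem_preimage, Set.mem_iInter]
    refine ⟨by rintro rfl; simp, fun ⟨hQ, hr⟩ => ?_⟩
    have hlaw : N.rewardLaw = M.rewardLaw := by
      funext a x
      have := N.rewardLaw_prob a x
      have := M.rewardLaw_prob a x
      refine ext_of_generate_finite _
        (BorelSpace.measurable_eq.trans Real.borel_eq_generateFrom_Iic_rat)
        Real.isPiSystem_Iic_rat (fun A hA => ?_) (by simp)
      simp only [Set.mem_iUnion, Set.mem_singleton_iff] at hA
      obtain ⟨q, rfl⟩ := hA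
      exact hr a x q
    cases N
    cases M
    congr
  rw [hset]
  refine (hmeas.fst (measurableSet_singleton _)).inter
    (.iInter fun a => .iInter fun x => .iInter fun q => ?_)
  have : Measurable fun N : MarkovianBandit S n => N.rewardLaw a x :=
    (measurable_pi_apply x).comp ((measurable_pi_apply a).comp hmeas.snd)
  exact (Measure.measurable_measure.1 this _ measurableSet_Iic) (measurableSet_singleton _)

/-! ### Bandits whose arms do not move -/

namespace MarkovianBandit

variable {S n : ℕ} (M : MarkovianBandit S n)

/-- The arms do not move. -/
def IsStatic : Prop := ∀ a x y, M.Q a x y = if x = y then 1 else 0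

/-- The mean reward of an arm in a state. -/
def meanReward (a : Fin n) (x : Fin S) : ℝ := ∫ r, r ∂(M.rewardLaw a x)

theorem trajKernel_zero (π : Policy S n) :
    M.trajKernel π 0 = (M.stepKernel π).map fun s _ => s := rfl

theorem trajKernel_succ_apply (π : Policy S n) (h : ℕ) (x : GlobalState S n) :
    M.trajKernel π (h + 1) x = (M.trajKernel π h x ⊗ₘ (M.nextKernel π).comap
      (fun e : Fin (h + 1) → Step S n => e (Fin.last h)) (by fun_prop)).map
        fun p => Fin.snoc (α := fun _ => Step S n) p.1 p.2 := by
  rw [trajKernel, Kernel.map_apply _ (measurable_snoc _),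
    Kernel.compProd_apply_eq_compProd_sectR]
  rfl

theorem stepKernel_apply (π : Policy S n) (x : GlobalState S n) :
    M.stepKernel π x = (M.rewardLaw (π x) (x (π x))).map fun r => (x, π x, r) := rfl

theorem ae_stepKernel (π : Policy S n) (x : GlobalState S n) :
    ∀ᵐ s ∂(M.stepKernel π x), s.1 = x := by
  have hm : MeasurableSet {s : Step S n | s.1 = x} :=
    measurable_fst (measurableSet_singleton x)
  rw [stepKernel_apply, ae_map_iff (by fun_prop) hm]
  exact .of_forall fun r => rfl

theorem ae_initial_state (π : Policy S n) (h : ℕ) (x : GlobalState S n) :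
    ∀ᵐ e ∂(M.trajKernel π h x), (e 0).1 = x := by
  have hms (h : ℕ) : MeasurableSet {e : Fin (h + 1) → Step S n | (e 0).1 = x} :=
    (measurable_fst.comp (measurable_pi_apply 0)) (measurableSet_singleton x)
  induction h with
  | zero =>
    rw [trajKernel_zero, Kernel.map_apply _ (by fun_prop), ae_map_iff (by fun_prop) (hms 0)]
    exact M.ae_stepKernel π x
  | succ h ih =>
    rw [trajKernel_succ_apply, ae_map_iff (measurable_snoc _).aemeasurable (hms _)]
    refine (Measure.ae_compProd_iff (measurable_snoc _ (hms (h + 1)))).2 ?_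
    filter_upwards [ih] with e he
    refine .of_forall fun s => ?_
    rw [← he]
    exact congrArg Prod.fst (Fin.snoc_castSucc (α := fun _ => Step S n) s e 0)

variable {M}

theorem IsStatic.nextKernel_apply (hM : M.IsStatic) (π : Policy S n) (s : Step S n) :
    M.nextKernel π s = M.stepKernel π s.1 := by
  have : M.transKernel (s.1, s.2.1) = Measure.dirac s.1 := by
    simp only [transKernel, Kernel.ofFunOfCountable, Kernel.coe_mk, hM _ _ _]
    rw [Finset.sum_eq_single (s.1 s.2.1)]
    · simp
    · intro y _ hy
      simp [Ne.symm hy]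
    · simp
  rw [nextKernel, Kernel.comp_apply, Kernel.comap_apply, this,
    Measure.dirac_bind (M.stepKernel π).measurable]

/-- The global state stays frozen, so each step repeats the law of the first one. -/
theorem IsStatic.map_last_trajKernel (hM : M.IsStatic) (π : Policy S n) (h : ℕ)
    (x : GlobalState S n) :
    (M.trajKernel π h x).map (fun e => e (Fin.last h)) = M.stepKernel π x := by
  induction h with
  | zero =>
    rw [trajKernel_zero, Kernel.map_apply _ (by fun_prop), Measure.map_map (by fun_prop)
      (by fun_prop)]
    exact Measure.map_id
  | succ h ih =>
    have hlast : (fun e : Fin (h + 1 + 1) → Step S n => e (Fin.last (h + 1))) ∘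
        (fun p : (Fin (h + 1) → Step S n) × Step S n =>
          Fin.snoc (α := fun _ => Step S n) p.1 p.2) = Prod.snd := by
      funext p
      exact Fin.snoc_last (α := fun _ => Step S n) p.2 p.1
    -- The induction hypothesis already shows that the last recorded state is still `x`.
    have hae : ∀ᵐ e ∂(M.trajKernel π h x), (e (Fin.last h)).1 = x := by
      refine ae_of_ae_map (f := fun e : Fin (h + 1) → Step S n => e (Fin.last h))
        (p := fun s => s.1 = x) (measurable_pi_apply _).aemeasurable ?_
      rw [ih]
      exact M.ae_stepKernel π x
    rw [trajKernel_succ_apply, Measure.map_map (by fun_prop) (measurable_snoc _), hlast]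
    change (_ : Measure _).snd = _
    rw [Measure.snd_compProd]
    ext A hA
    rw [Measure.bind_apply hA (Kernel.aemeasurable _)]
    have : ∫⁻ e, ((M.nextKernel π).comap (fun e : Fin (h + 1) → Step S n => e (Fin.last h))
        (by fun_prop)) e A ∂(M.trajKernel π h x) =
        ∫⁻ e, M.stepKernel π x A ∂(M.trajKernel π h x) := by
      refine lintegral_congr_ae ?_
      filter_upwards [hae] with e he
      rw [Kernel.comap_apply, hM.nextKernel_apply, he]
    rw [this]
    simp

theorem IsStatic.ae_last_state (hM : M.IsStatic) (π : Policy S n) (h : ℕ) (x : GlobalState S n) :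
    ∀ᵐ e ∂(M.trajKernel π h x), (e (Fin.last h)).1 = x := by
  refine ae_of_ae_map (f := fun e : Fin (h + 1) → Step S n => e (Fin.last h))
    (p := fun s => s.1 = x) (measurable_pi_apply _).aemeasurable ?_
  rw [hM.map_last_trajKernel]
  exact M.ae_stepKernel π x

theorem IsStatic.value_eq (hM : M.IsStatic) {β : ℝ} (hβ0 : 0 ≤ β) (hβ1 : β < 1)
    (π : Policy S n) (x : GlobalState S n) :
    M.value β π x = M.meanReward (π x) (x (π x)) / (1 - β) := by
  have (t : ℕ) : ∫ e, (e (Fin.last t)).2.2 ∂(M.trajKernel π t x) =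
      M.meanReward (π x) (x (π x)) := by
    have h1 := integral_map (μ := M.trajKernel π t x)
      (φ := fun e : Fin (t + 1) → Step S n => e (Fin.last t)) (measurable_pi_apply _).aemeasurable
      (f := fun s => s.2.2) (Measurable.aestronglyMeasurable (by fun_prop))
    rw [← h1, hM.map_last_trajKernel, stepKernel_apply, integral_map (by fun_prop)
      (Measurable.aestronglyMeasurable (by fun_prop))]
    rfl
  simp only [value, this]
  rw [tsum_mul_right, tsum_geometric_of_lt_one hβ0 hβ1, div_eq_inv_mul]

end MarkovianBandit

/-! ### The geometric episode length -/

theorem hasSum_geometric_weights {β : ℝ} (hβ0 : 0 ≤ β) (hβ1 : β < 1) :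
    HasSum (fun h : ℕ => (1 - β) * β ^ h) 1 := by
  have := (hasSum_geometric_of_lt_one hβ0 hβ1).mul_left (1 - β)
  rwa [mul_inv_cancel₀ (by linarith)] at this

/-- The mean episode length; the factor is `h + 1` because the index `h` stands for length `h + 1`.
-/
theorem hasSum_geometric_mean {β : ℝ} (hβ0 : 0 ≤ β) (hβ1 : β < 1) :
    HasSum (fun h : ℕ => (1 - β) * β ^ h * (h + 1)) (1 / (1 - β)) := by
  have h1 := hasSum_coe_mul_geometric_of_norm_lt_one (𝕜 := ℝ) (r := β)
    (by rwa [Real.norm_of_nonneg hβ0])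
  have h2 := (h1.add (hasSum_geometric_of_lt_one hβ0 hβ1)).mul_left (1 - β)
  have hne : 1 - β ≠ 0 := by linarith
  have e1 : (fun h : ℕ => (1 - β) * β ^ h * (h + 1)) =
      fun h : ℕ => (1 - β) * (h * β ^ h + β ^ h) := by
    funext h
    ring
  have e2 : 1 / (1 - β) = (1 - β) * (β / (1 - β) ^ 2 + (1 - β)⁻¹) := by
    field_simp
    ring
  rw [e1, e2]
  exact h2

theorem exists_abs_le {α : Type*} [Finite α] (c : α → ℝ) : ∃ C, ∀ x, |c x| ≤ C := by
  obtain ⟨C, hC⟩ := (Set.finite_range fun x => |c x|).bddAbove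
  exact ⟨C, fun x => hC ⟨x, rfl⟩⟩

/-! ### Information gathered by a learning algorithm -/

namespace MarkovianBandit

variable {S n : ℕ} {M M' : MarkovianBandit S n} {d : Fin n → Fin S → ℝ} {β : ℝ}

theorem relEntropyLE_stepKernel
    (hd : ∀ a x, RelEntropyLE (M.rewardLaw a x) (M'.rewardLaw a x) (d a x))
    (π : Policy S n) (x : GlobalState S n) :
    RelEntropyLE (M.stepKernel π x) (M'.stepKernel π x) (d (π x) (x (π x))) :=
  (hd _ _).map (by fun_prop)

/-- With a frozen state the same arm is pulled `h + 1` times, and each pull adds the entropy of its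
reward law. -/
theorem IsStatic.relEntropyLE_trajKernel (hM : M.IsStatic) (hM' : M'.IsStatic)
    (hd : ∀ a x, RelEntropyLE (M.rewardLaw a x) (M'.rewardLaw a x) (d a x))
    (π : Policy S n) (h : ℕ) (x : GlobalState S n) :
    RelEntropyLE (M.trajKernel π h x) (M'.trajKernel π h x) ((h + 1) * d (π x) (x (π x))) := by
  induction h with
  | zero =>
    rw [trajKernel_zero, trajKernel_zero, Kernel.map_apply _ (by fun_prop),
      Kernel.map_apply _ (by fun_prop)]
    simpa using (relEntropyLE_stepKernel hd π x).map (f := fun s (_ : Fin 1) => s) (by fun_prop)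
  | succ h ih =>
    rw [trajKernel_succ_apply, trajKernel_succ_apply]
    have := ih.compProd (κ := (M.nextKernel π).comap
      (fun e : Fin (h + 1) → Step S n => e (Fin.last h)) (by fun_prop))
      (η := (M'.nextKernel π).comap
      (fun e : Fin (h + 1) → Step S n => e (Fin.last h)) (by fun_prop))
      (d := fun _ => d (π x) (x (π x))) (integrable_const _) (by
        filter_upwards [hM.ae_last_state π h x] with e he
        rw [Kernel.comap_apply, Kernel.comap_apply, hM.nextKernel_apply, hM'.nextKernel_apply, he]
        exact relEntropyLE_stepKernel hd π x)
    refine (this.map (measurable_snoc _)).mono (le_of_eq ?_)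
    simp
    ring

/-- The initial state and the length have the same law in both models and cost nothing. Averaging
over the length replaces `h + 1` by its mean `1 / (1 - β)`. -/
theorem IsStatic.relEntropyLE_episodeKernel (hM : M.IsStatic) (hM' : M'.IsStatic)
    (hd : ∀ a x, RelEntropyLE (M.rewardLaw a x) (M'.rewardLaw a x) (d a x))
    (hβ0 : 0 ≤ β) (hβ1 : β < 1) (ρ : PMF (GlobalState S n)) (π : Policy S n) :
    RelEntropyLE (M.episodeKernel β ρ π) (M'.episodeKernel β ρ π)
      (1 / (1 - β) * ∫ x, d (π x) (x (π x)) ∂ρ.toMeasure) := by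
  have hprob (N : MarkovianBandit S n) (h : ℕ) : IsProbabilityMeasure
      (((N.trajKernel π h) ∘ₘ ρ.toMeasure).map
        (Sigma.mk (β := fun h : ℕ => Fin (h + 1) → Step S n) h)) :=
    Measure.isProbabilityMeasure_map (measurable_sigma_mk h).aemeasurable
  refine RelEntropyLE.sum (fun h => mul_nonneg (by linarith) (pow_nonneg hβ0 h))
    (hasSum_geometric_weights hβ0 hβ1)
    (d := fun h => (h + 1) * ∫ x, d (π x) (x (π x)) ∂ρ.toMeasure) ?_ fun h => ?_
  · simpa only [mul_assoc] using (hasSum_geometric_mean hβ0 hβ1).mul_right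
      (∫ x, d (π x) (x (π x)) ∂ρ.toMeasure)
  · refine RelEntropyLE.map ?_ (measurable_sigma_mk h)
    rw [← Measure.snd_compProd, ← Measure.snd_compProd, ← integral_const_mul]
    have := (RelEntropyLE.refl ρ.toMeasure).compProd (κ := M.trajKernel π h)
      (η := M'.trajKernel π h) (d := fun x => (h + 1) * d (π x) (x (π x)))
      .of_finite (.of_forall fun x => hM.relEntropyLE_trajKernel hM' hd π h x)
    rw [zero_add] at this
    exact this.map measurable_snd

/-- The law of the policy used after `k` episodes. -/
def policyDist (M : MarkovianBandit S n) (β : ℝ) (ρ : PMF (GlobalState S n))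
    (L : LearningAlgorithm S n) (k : ℕ) : Measure (Policy S n) :=
  (L.policyLaw k).comap (fun w i => (w i).2) (by fun_prop) ∘ₘ M.runLaw β ρ L k

variable (ρ : PMF (GlobalState S n)) (L : LearningAlgorithm S n)

theorem isProbabilityMeasure_policyDist (M : MarkovianBandit S n) (hβ0 : 0 ≤ β) (hβ1 : β < 1)
    (k : ℕ) : IsProbabilityMeasure (M.policyDist β ρ L k) := by
  have := M.isProbabilityMeasure_runLaw hβ0 hβ1 ρ L k
  have := L.policyLaw_markov k
  unfold policyDist
  infer_instance

theorem measurable_integral_policyLaw (k : ℕ) (c : Policy S n → ℝ) :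
    Measurable fun w : Fin k → Policy S n × Episode S n =>
      ∫ π, c π ∂(L.policyLaw k fun i => (w i).2) := by
  have := L.policyLaw_markov k
  have h : Measurable fun w : Fin k → Episode S n => ∫ π, c π ∂(L.policyLaw k w) :=
    (Measurable.of_discrete (f := c)).stronglyMeasurable.integral_kernel.measurable
  exact h.comp (by fun_prop)

theorem abs_integral_policyLaw_le (k : ℕ) {c : Policy S n → ℝ} {C : ℝ} (hC : ∀ π, |c π| ≤ C)
    (w : Fin k → Episode S n) : |∫ π, c π ∂(L.policyLaw k w)| ≤ C := by
  have := L.policyLaw_markov k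
  simpa using norm_integral_le_of_norm_le_const (μ := L.policyLaw k w) (f := c) (.of_forall hC)

theorem integrable_integral_policyLaw (M : MarkovianBandit S n) (hβ0 : 0 ≤ β) (hβ1 : β < 1)
    (k : ℕ) (c : Policy S n → ℝ) :
    Integrable (fun w : Fin k → Policy S n × Episode S n =>
      ∫ π, c π ∂(L.policyLaw k fun i => (w i).2)) (M.runLaw β ρ L k) := by
  have := M.isProbabilityMeasure_runLaw hβ0 hβ1 ρ L k
  obtain ⟨C, hC⟩ := exists_abs_le c
  exact integrable_of_abs_le _ (measurable_integral_policyLaw L k c)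
    fun w => abs_integral_policyLaw_le L k hC _

theorem integral_policyDist (M : MarkovianBandit S n) (hβ0 : 0 ≤ β) (hβ1 : β < 1) (k : ℕ)
    (c : Policy S n → ℝ) :
    ∫ π, c π ∂(M.policyDist β ρ L k) =
      ∫ w, ∫ π, c π ∂(L.policyLaw k fun i => (w i).2) ∂(M.runLaw β ρ L k) := by
  have := M.isProbabilityMeasure_policyDist ρ L hβ0 hβ1 k
  have := M.isProbabilityMeasure_runLaw hβ0 hβ1 ρ L k
  have := L.policyLaw_markov k
  obtain ⟨C, hC⟩ := exists_abs_le c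
  have hm : Measurable fun p : (Fin k → Policy S n × Episode S n) × Policy S n => c p.2 :=
    (Measurable.of_discrete (f := c)).comp measurable_snd
  rw [policyDist, ← Measure.snd_compProd, Measure.snd, integral_map measurable_snd.aemeasurable
    Measurable.of_discrete.aestronglyMeasurable, Measure.integral_compProd
    (integrable_of_abs_le _ hm fun p => hC p.2)]
  rfl

theorem roundKernel_apply (M : MarkovianBandit S n) (hβ0 : 0 ≤ β) (hβ1 : β < 1) (k : ℕ)
    (w : Fin k → Policy S n × Episode S n) :
    M.roundKernel β ρ L k w = L.policyLaw k (fun i => (w i).2) ⊗ₘ M.episodeKernel β ρ := by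
  have := M.isMarkovKernel_episodeKernel hβ0 hβ1 ρ
  have := L.policyLaw_markov k
  rw [roundKernel, Kernel.compProd_apply_eq_compProd_sectR]
  rfl

/-- Given the past observations, the algorithm draws its policy in the same way in both models, so
only the episodes add entropy. The expected costs are taken under `M`, the first argument, which
will be the reference model. -/
theorem IsStatic.relEntropyLE_runLaw (hM : M.IsStatic) (hM' : M'.IsStatic)
    (hd : ∀ a x, RelEntropyLE (M.rewardLaw a x) (M'.rewardLaw a x) (d a x))
    (hβ0 : 0 ≤ β) (hβ1 : β < 1) (k : ℕ) :
    RelEntropyLE (M.runLaw β ρ L k) (M'.runLaw β ρ L k)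
      (∑ j ∈ Finset.range k, ∫ π, 1 / (1 - β) * ∫ x, d (π x) (x (π x)) ∂ρ.toMeasure
        ∂(M.policyDist β ρ L j)) := by
  induction k with
  | zero => simpa [runLaw] using RelEntropyLE.refl _
  | succ k ih =>
    have := M.isProbabilityMeasure_runLaw hβ0 hβ1 ρ L k
    have := M'.isProbabilityMeasure_runLaw hβ0 hβ1 ρ L k
    have := L.policyLaw_markov k
    have := M.isMarkovKernel_episodeKernel hβ0 hβ1 ρ
    have := M'.isMarkovKernel_episodeKernel hβ0 hβ1 ρ
    have : IsMarkovKernel (M.roundKernel β ρ L k) := by unfold roundKernel; infer_instance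
    have : IsMarkovKernel (M'.roundKernel β ρ L k) := by unfold roundKernel; infer_instance
    rw [Finset.sum_range_succ, integral_policyDist ρ L M hβ0 hβ1]
    refine (ih.compProd (integrable_integral_policyLaw ρ L M hβ0 hβ1 k _)
      (.of_forall fun w => ?_)).map (measurable_snoc k)
    rw [roundKernel_apply ρ L M hβ0 hβ1, roundKernel_apply ρ L M' hβ0 hβ1]
    have := (RelEntropyLE.refl (L.policyLaw k fun i => (w i).2)).compProd .of_finite
      (.of_forall fun π => hM.relEntropyLE_episodeKernel hM' hd hβ0 hβ1 ρ π)
    rwa [zero_add] at this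

theorem IsStatic.relEntropyLE_policyDist (hM : M.IsStatic) (hM' : M'.IsStatic)
    (hd : ∀ a x, RelEntropyLE (M.rewardLaw a x) (M'.rewardLaw a x) (d a x))
    (hβ0 : 0 ≤ β) (hβ1 : β < 1) (k : ℕ) :
    RelEntropyLE (M.policyDist β ρ L k) (M'.policyDist β ρ L k)
      (∑ j ∈ Finset.range k, ∫ π, 1 / (1 - β) * ∫ x, d (π x) (x (π x)) ∂ρ.toMeasure
        ∂(M.policyDist β ρ L j)) := by
  have := M.isProbabilityMeasure_runLaw hβ0 hβ1 ρ L k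
  have := M'.isProbabilityMeasure_runLaw hβ0 hβ1 ρ L k
  have := L.policyLaw_markov k
  have key := (hM.relEntropyLE_runLaw ρ L hM' hd hβ0 hβ1 k).compProd
    (κ := (L.policyLaw k).comap (fun w i => (w i).2) (by fun_prop))
    (η := (L.policyLaw k).comap (fun w i => (w i).2) (by fun_prop))
    (integrable_const 0) (.of_forall fun w => RelEntropyLE.refl _)
  rw [integral_zero, add_zero] at key
  unfold policyDist at key ⊢
  rw [← Measure.snd_compProd, ← Measure.snd_compProd]
  exact key.map measurable_snd

/-! ### The expected regret as a sum over episodes -/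

theorem measurable_initialState :
    Measurable fun e : Episode S n => (e.2 0).1 :=
  measurable_of_sigma fun h => measurable_fst.comp (measurable_pi_apply (0 : Fin (h + 1)))

theorem map_initialState_episodeKernel (M : MarkovianBandit S n) (hβ0 : 0 ≤ β) (hβ1 : β < 1)
    (π : Policy S n) :
    (M.episodeKernel β ρ π).map (fun e => (e.2 0).1) = ρ.toMeasure := by
  have hm (h : ℕ) : Measurable fun e : Fin (h + 1) → Step S n => (e 0).1 :=
    measurable_fst.comp (measurable_pi_apply 0)
  have hker (h : ℕ) : (M.trajKernel π h).map (fun e => (e 0).1) = Kernel.id := by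
    ext1 x
    rw [Kernel.map_apply _ (hm h), Kernel.id_apply, Measure.map_congr (M.ae_initial_state π h x),
      Measure.map_const, measure_univ, one_smul]
  have hmap (h : ℕ) : ((M.trajKernel π h ∘ₘ ρ.toMeasure).map
      (Sigma.mk (β := fun h : ℕ => Fin (h + 1) → Step S n) h)).map (fun e => (e.2 0).1) =
      ρ.toMeasure := by
    rw [Measure.map_map measurable_initialState (measurable_sigma_mk h)]
    change (M.trajKernel π h ∘ₘ ρ.toMeasure).map (fun e => (e 0).1) = _
    rw [Measure.map_comp _ _ (hm h), hker, Measure.id_comp]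
  ext A hA
  have hw (h : ℕ) : 0 ≤ (1 - β) * β ^ h := mul_nonneg (by linarith) (pow_nonneg hβ0 h)
  have hmapA (h : ℕ) := congrArg (fun μ => μ A) (hmap h)
  simp only [Measure.map_apply measurable_initialState hA] at hmapA
  rw [Measure.map_apply measurable_initialState hA]
  simp only [episodeKernel, Kernel.ofFunOfCountable, Kernel.coe_mk,
    Measure.sum_apply _ (measurable_initialState hA), Measure.smul_apply, hmapA, smul_eq_mul]
  rw [ENNReal.tsum_mul_right, ← ENNReal.ofReal_tsum_of_nonneg hw
    (hasSum_geometric_weights hβ0 hβ1).summable, (hasSum_geometric_weights hβ0 hβ1).tsum_eq,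
    ENNReal.ofReal_one, one_mul]

theorem integral_roundKernel (M : MarkovianBandit S n) (hβ0 : 0 ≤ β) (hβ1 : β < 1) (k : ℕ)
    (G : Policy S n → GlobalState S n → ℝ) (w : Fin k → Policy S n × Episode S n) :
    ∫ p, G p.1 (p.2.2 0).1 ∂(M.roundKernel β ρ L k w) =
      ∫ π, ∫ x, G π x ∂ρ.toMeasure ∂(L.policyLaw k fun i => (w i).2) := by
  have := L.policyLaw_markov k
  have := M.isMarkovKernel_episodeKernel hβ0 hβ1 ρ
  obtain ⟨C, hC⟩ := exists_abs_le (Function.uncurry G)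
  have hm : Measurable fun p : Policy S n × Episode S n => G p.1 (p.2.2 0).1 :=
    (Measurable.of_discrete (f := Function.uncurry G)).comp
      (measurable_fst.prodMk (measurable_initialState.comp measurable_snd))
  rw [roundKernel_apply ρ L M hβ0 hβ1, Measure.integral_compProd
    (integrable_of_abs_le _ hm fun p => hC (p.1, (p.2.2 0).1))]
  congr 1
  funext π
  rw [← map_initialState_episodeKernel ρ M hβ0 hβ1 π,
    integral_map measurable_initialState.aemeasurable Measurable.of_discrete.aestronglyMeasurable]

/-- Whatever the past and the chosen policy, the recorded initial state has law `ρ`. The regret of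
an episode therefore depends on the run only through the law of its policy. -/
theorem expectedRegret_eq_sum (M : MarkovianBandit S n) (hβ0 : 0 ≤ β) (hβ1 : β < 1) (K : ℕ) :
    M.expectedRegret β ρ L K = ∑ k ∈ Finset.range K,
      ∫ π, ∫ x, (M.optValue β x - M.value β π x) ∂ρ.toMeasure ∂(M.policyDist β ρ L k) := by
  obtain ⟨C, hC⟩ := exists_abs_le
    fun p : Policy S n × GlobalState S n => M.optValue β p.2 - M.value β p.1 p.2
  have hm : Measurable fun p : Policy S n × Episode S n =>
      M.optValue β (p.2.2 0).1 - M.value β p.1 (p.2.2 0).1 :=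
    (Measurable.of_discrete
      (f := fun p : Policy S n × GlobalState S n => M.optValue β p.2 - M.value β p.1 p.2)).comp
      (measurable_fst.prodMk (measurable_initialState.comp measurable_snd))
  have hreg (k : ℕ) : Measurable (M.regret (K := k) β) :=
    Finset.measurable_sum _ fun i _ => hm.comp (measurable_pi_apply i)
  have hregC (k : ℕ) (w : Fin k → Policy S n × Episode S n) : |M.regret β w| ≤ k * C := by
    refine (Finset.abs_sum_le_sum_abs _ _).trans ?_
    refine (Finset.sum_le_sum fun i _ => hC ((w i).1, ((w i).2.2 0).1)).trans ?_
    simp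
  induction K with
  | zero => simp [expectedRegret, regret]
  | succ k ih =>
    have := M.isProbabilityMeasure_runLaw hβ0 hβ1 ρ L k
    have := L.policyLaw_markov k
    have := M.isMarkovKernel_episodeKernel hβ0 hβ1 ρ
    have : IsMarkovKernel (M.roundKernel β ρ L k) := by unfold roundKernel; infer_instance
    rw [Finset.sum_range_succ, ← ih, integral_policyDist ρ L M hβ0 hβ1]
    have hsnoc (p : (Fin k → Policy S n × Episode S n) × (Policy S n × Episode S n)) :
        M.regret β (Fin.snoc (α := fun _ => Policy S n × Episode S n) p.1 p.2) =
          M.regret β p.1 +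
            (M.optValue β (p.2.2.2 0).1 - M.value β p.2.1 (p.2.2.2 0).1) := by
      have hc (i : Fin k) :
          Fin.snoc (α := fun _ => Policy S n × Episode S n) p.1 p.2 i.castSucc = p.1 i :=
        Fin.snoc_castSucc (α := fun _ => Policy S n × Episode S n) p.2 p.1 i
      have hl : Fin.snoc (α := fun _ => Policy S n × Episode S n) p.1 p.2 (Fin.last k) = p.2 :=
        Fin.snoc_last (α := fun _ => Policy S n × Episode S n) p.2 p.1
      rw [regret, Fin.sum_univ_castSucc]
      refine congrArg₂ (· + ·) (Finset.sum_congr rfl fun i _ => ?_) ?_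
      · exact congrArg (fun q : Policy S n × Episode S n =>
          M.optValue β (q.2.2 0).1 - M.value β q.1 (q.2.2 0).1) (hc i)
      · exact congrArg (fun q : Policy S n × Episode S n =>
          M.optValue β (q.2.2 0).1 - M.value β q.1 (q.2.2 0).1) hl
    rw [expectedRegret, runLaw, integral_map (measurable_snoc _).aemeasurable
      (hreg _).aestronglyMeasurable]
    simp only [hsnoc]
    have h1 : Integrable (fun p : (Fin k → Policy S n × Episode S n) × (Policy S n × Episode S n) =>
        M.regret β p.1) (M.runLaw β ρ L k ⊗ₘ M.roundKernel β ρ L k) :=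
      integrable_of_abs_le _ ((hreg k).comp measurable_fst) fun p => hregC k p.1
    have h2 : Integrable (fun p : (Fin k → Policy S n × Episode S n) × (Policy S n × Episode S n) =>
        M.optValue β (p.2.2.2 0).1 - M.value β p.2.1 (p.2.2.2 0).1)
        (M.runLaw β ρ L k ⊗ₘ M.roundKernel β ρ L k) :=
      integrable_of_abs_le _ (hm.comp measurable_snd) fun p => hC (p.2.1, (p.2.2.2 0).1)
    rw [integral_add h1 h2, Measure.integral_compProd h1, Measure.integral_compProd h2]
    congr 1
    · simp [expectedRegret]
    · congr 1
      funext w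
      exact integral_roundKernel ρ L M hβ0 hβ1 k
        (fun π x => M.optValue β x - M.value β π x) w

end MarkovianBandit

/-! ### Bernoulli rewards and the uniform diagonal start -/

/-- The Bernoulli law on `{0, 1}` with mean `p`. -/
def bernoulliLaw (p : ℝ) : Measure ℝ :=
  ENNReal.ofReal p • Measure.dirac 1 + ENNReal.ofReal (1 - p) • Measure.dirac 0

theorem isProbabilityMeasure_bernoulliLaw {p : ℝ} (hp : p ∈ Set.Icc (0 : ℝ) 1) :
    IsProbabilityMeasure (bernoulliLaw p) := by
  refine ⟨?_⟩
  simp only [bernoulliLaw, Measure.add_apply, Measure.smul_apply, measure_univ, smul_eq_mul,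
    mul_one]
  rw [← ENNReal.ofReal_add hp.1 (sub_nonneg.2 hp.2), add_sub_cancel, ENNReal.ofReal_one]

theorem bernoulliLaw_mem (p : ℝ) : ∀ᵐ r ∂(bernoulliLaw p), r ∈ Set.Icc (0 : ℝ) 1 := by
  rw [bernoulliLaw, ae_add_measure_iff]
  constructor <;> refine Measure.ae_smul_measure ?_ _ <;>
    simp [ae_dirac_eq]

theorem integral_bernoulliLaw {p : ℝ} (hp : p ∈ Set.Icc (0 : ℝ) 1) (g : ℝ → ℝ) :
    ∫ r, g r ∂(bernoulliLaw p) = p * g 1 + (1 - p) * g 0 := by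
  have hi (x : ℝ) (c : ℝ) : Integrable g (ENNReal.ofReal c • Measure.dirac x) :=
    (integrable_dirac (by simp)).smul_measure ENNReal.ofReal_ne_top
  rw [bernoulliLaw, integral_add_measure (hi _ _) (hi _ _), integral_smul_measure,
    integral_smul_measure, integral_dirac, integral_dirac, ENNReal.toReal_ofReal hp.1,
    ENNReal.toReal_ofReal (sub_nonneg.2 hp.2), smul_eq_mul, smul_eq_mul]

/-- The exact relative entropy is `-(1/2) log (1 - 4 δ²)`. For `u = 4 δ² ≤ 1/16` one has `-log (1 -
u) ≤ u / (1 - u) ≤ (16/15) u`, whence the constant `32/15`. -/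
theorem relEntropyLE_bernoulliLaw {δ : ℝ} (h0 : 0 ≤ δ) (h1 : δ ≤ 1 / 8) :
    RelEntropyLE (bernoulliLaw (1 / 2)) (bernoulliLaw (1 / 2 + δ)) (32 / 15 * δ ^ 2) := by
  rintro g - -
  rw [integral_bernoulliLaw (by norm_num), integral_bernoulliLaw (by constructor <;> linarith)]
  have hexp (u y : ℝ) (hu : 0 < u) : 1 + y + Real.log u ≤ u * Real.exp y := by
    have := Real.add_one_le_exp (y + Real.log u)
    rw [Real.exp_add, Real.exp_log hu] at this
    linarith
  have hu : 0 < 1 + 2 * δ := by linarith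
  have hv : 0 < 1 - 2 * δ := by linarith
  have e1 := hexp (1 + 2 * δ) (g 1) hu
  have e2 := hexp (1 - 2 * δ) (g 0) hv
  have hlog : -(64 / 15 * δ ^ 2) ≤ Real.log (1 + 2 * δ) + Real.log (1 - 2 * δ) := by
    rw [← Real.log_mul hu.ne' hv.ne']
    have huv : 0 < (1 + 2 * δ) * (1 - 2 * δ) := mul_pos hu hv
    have h := Real.one_sub_inv_le_log_of_pos huv
    refine le_trans ?_ h
    have hsq : δ ^ 2 ≤ 1 / 64 := by nlinarith
    have : ((1 + 2 * δ) * (1 - 2 * δ))⁻¹ ≤ 1 + 64 / 15 * δ ^ 2 := by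
      rw [inv_le_iff_one_le_mul₀ huv]
      nlinarith [sq_nonneg δ, mul_nonneg (sq_nonneg δ) (sub_nonneg.2 hsq)]
    linarith
  linarith

/-- The uniform law on the diagonal global states. -/
def diagonalLaw (S n : ℕ) [NeZero S] : PMF (GlobalState S n) :=
  (PMF.uniformOfFintype (Fin S)).map fun s _ => s

theorem integral_diagonalLaw (S n : ℕ) [NeZero S] (f : GlobalState S n → ℝ) :
    ∫ x, f x ∂(diagonalLaw S n).toMeasure = (∑ s, f fun _ => s) / S := by
  rw [diagonalLaw, ← PMF.toMeasure_map _ _ Measurable.of_discrete,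
    integral_map Measurable.of_discrete.aemeasurable Measurable.of_discrete.aestronglyMeasurable,
    PMF.integral_eq_sum, Finset.sum_div]
  refine Finset.sum_congr rfl fun s _ => ?_
  simp [div_eq_inv_mul]

/-- Resampling one coordinate of a function. -/
theorem card_mul_sum_eq_sum_update {ι α : Type*} [Fintype ι] [DecidableEq ι] [Fintype α]
    (i : ι) (h : (ι → α) → ℝ) :
    (Fintype.card α : ℝ) * ∑ θ, h θ = ∑ θ, ∑ a, h (Function.update θ i a) := by
  classical
  -- Swapping the coordinate `θ i` with the extra sample `a` is an involution, so it preserves the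
  -- sum.
  let f : (ι → α) × α → (ι → α) × α := fun p => (Function.update p.1 i p.2, p.1 i)
  have hf : Function.Involutive f := fun p => by simp [f]
  calc (Fintype.card α : ℝ) * ∑ θ, h θ = ∑ p : (ι → α) × α, h p.1 := by
        simp [Fintype.sum_prod_type, Finset.mul_sum]
    _ = ∑ p : (ι → α) × α, h (f p).1 :=
        (Equiv.sum_comp (Function.Involutive.toPerm f hf) fun p => h p.1).symm
    _ = _ := by rw [Fintype.sum_prod_type]

/-! ### Planted instances and their Bayesian regret -/

namespace MarkovianBandit

variable {S n : ℕ} {δ : ℝ}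

/-- The arms do not move, and the rewards are Bernoulli with mean `1 / 2`, except that in state `x`
the arm `θ x`, if any, has mean `1 / 2 + δ`. -/
def planted (hδ : δ ∈ Set.Icc (0 : ℝ) (1 / 8)) (θ : Fin S → Option (Fin n)) :
    MarkovianBandit S n where
  Q _ x y := if x = y then 1 else 0
  Q_nonneg _ x y := by split <;> norm_num
  Q_sum _ x := by simp
  rewardLaw a x := bernoulliLaw (1 / 2 + if θ x = some a then δ else 0)
  rewardLaw_prob a x := isProbabilityMeasure_bernoulliLaw (by
    have := hδ.1
    have := hδ.2
    split <;> constructor <;> linarith)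
  rewardLaw_mem a x := bernoulliLaw_mem _

variable (hδ : δ ∈ Set.Icc (0 : ℝ) (1 / 8)) {β : ℝ}

theorem isStatic_planted (θ : Fin S → Option (Fin n)) : (planted hδ θ).IsStatic :=
  fun _ _ _ => rfl

theorem meanReward_planted (θ : Fin S → Option (Fin n)) (a : Fin n) (x : Fin S) :
    (planted hδ θ).meanReward a x = 1 / 2 + if θ x = some a then δ else 0 := by
  have h0 := hδ.1
  have h1 := hδ.2
  have := integral_bernoulliLaw (p := 1 / 2 + if θ x = some a then δ else 0)
    (by split <;> constructor <;> linarith) id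
  simpa [meanReward, planted] using this

theorem optValue_sub_value_planted (hβ0 : 0 ≤ β) (hβ1 : β < 1) (θ : Fin S → Fin n)
    (π : Policy S n) (s : Fin S) :
    (planted hδ (some ∘ θ)).optValue β (fun _ => s) -
        (planted hδ (some ∘ θ)).value β π (fun _ => s) =
      δ / (1 - β) * (1 - if π (fun _ => s) = θ s then 1 else 0) := by
  have hval (π : Policy S n) : (planted hδ (some ∘ θ)).value β π (fun _ => s) =
      (1 / 2 + if θ s = π (fun _ => s) then δ else 0) / (1 - β) := by
    rw [(isStatic_planted hδ _).value_eq hβ0 hβ1, meanReward_planted]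
    simp
  have hpos : 0 < 1 - β := by linarith
  have : Nonempty (Policy S n) := ⟨π⟩
  have hopt : (planted hδ (some ∘ θ)).optValue β (fun _ => s) = (1 / 2 + δ) / (1 - β) := by
    refine le_antisymm (ciSup_le fun π' => ?_) ?_
    · rw [hval]
      gcongr
      split
      · exact le_rfl
      · exact hδ.1
    · refine le_ciSup_of_le (Set.finite_range _).bddAbove (fun _ => θ s) ?_
      rw [hval, if_pos rfl]
  rw [hopt, hval]
  simp only [eq_comm (a := θ s)]
  split <;> ring

/-- The prior that plants an independent uniform best arm in every state. -/
def plantedPrior (S n : ℕ) : Measure (MarkovianBandit S n) :=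
  ∑ θ : Fin S → Fin n, ((n : ℝ≥0∞) ^ S)⁻¹ • Measure.dirac (planted hδ (some ∘ θ))

theorem isProbabilityMeasure_plantedPrior (hn : 0 < n) :
    IsProbabilityMeasure (plantedPrior hδ S n) := by
  refine ⟨?_⟩
  simp only [plantedPrior, Measure.coe_finsetSum, Finset.sum_apply, Measure.smul_apply,
    measure_univ, smul_eq_mul, mul_one, Finset.sum_const, Finset.card_univ, Fintype.card_fun,
    Fintype.card_fin, nsmul_eq_mul, Nat.cast_pow]
  exact ENNReal.mul_inv_cancel (by simp [hn.ne']) (by finiteness)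

theorem integral_plantedPrior (f : MarkovianBandit S n → ℝ) :
    ∫ M, f M ∂(plantedPrior hδ S n) = (∑ θ : Fin S → Fin n, f (planted hδ (some ∘ θ))) / n ^ S := by
  rcases Nat.eq_zero_or_pos n with rfl | hn
  · rcases Nat.eq_zero_or_pos S with rfl | hS
    · simp [plantedPrior]
    · have : Nonempty (Fin S) := ⟨⟨0, hS⟩⟩
      simp [plantedPrior]
  · rw [plantedPrior, integral_finsetSum_measure fun θ _ =>
      (integrable_dirac (by simp)).smul_measure (by simp [hn.ne']), Finset.sum_div]
    refine Finset.sum_congr rfl fun θ _ => ?_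
    rw [integral_smul_measure, integral_dirac]
    simp [div_eq_inv_mul]

variable [NeZero S]

/-- The probability that the policy of episode `k + 1` activates the arm `a` in state `s`. -/
def choiceProb (β : ℝ) (L : LearningAlgorithm S n) (θ : Fin S → Option (Fin n)) (k : ℕ)
    (s : Fin S) (a : Fin n) : ℝ :=
  ∫ π, (if π (fun _ => s) = a then 1 else 0)
    ∂((planted hδ θ).policyDist β (diagonalLaw S n) L k)

variable (L : LearningAlgorithm S n)

theorem sum_choiceProb (hβ0 : 0 ≤ β) (hβ1 : β < 1) (θ : Fin S → Option (Fin n)) (k : ℕ)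
    (s : Fin S) : ∑ a, choiceProb hδ β L θ k s a = 1 := by
  have := (planted hδ θ).isProbabilityMeasure_policyDist (diagonalLaw S n) L hβ0 hβ1 k
  unfold choiceProb
  rw [← integral_finsetSum _ fun a _ => .of_finite]
  simp

/-- Erasing the bonus at `s` alone gives a model that differs only in the reward of arm `θ s` in
state `s`. The entropy then counts the episodes that start at `s` (probability `1 / S`) and choose
that arm, each weighted by the mean length `1 / (1 - β)`. -/
theorem choiceProb_le (hβ0 : 0 ≤ β) (hβ1 : β < 1) (θ : Fin S → Fin n) (k : ℕ) (s : Fin S) :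
    choiceProb hδ β L (some ∘ θ) k s (θ s) ≤
      2 * Real.log 2 * choiceProb hδ β L (Function.update (some ∘ θ) s none) k s (θ s) +
        2 * ∑ j ∈ Finset.range k, 32 / 15 * δ ^ 2 / ((1 - β) * S) *
          choiceProb hδ β L (Function.update (some ∘ θ) s none) j s (θ s) := by
  set θ₀ := Function.update (some ∘ θ) s none with hθ₀
  have h1 := (planted hδ θ₀).isProbabilityMeasure_policyDist (diagonalLaw S n) L hβ0 hβ1 k
  have h2 := (planted hδ (some ∘ θ)).isProbabilityMeasure_policyDist (diagonalLaw S n) L hβ0 hβ1 k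
  have hd (a : Fin n) (x : Fin S) : RelEntropyLE ((planted hδ θ₀).rewardLaw a x)
      ((planted hδ (some ∘ θ)).rewardLaw a x)
      (if x = s ∧ a = θ s then 32 / 15 * δ ^ 2 else 0) := by
    by_cases hx : x = s
    · subst hx
      by_cases ha : a = θ x
      · simpa [planted, hθ₀, ha] using relEntropyLE_bernoulliLaw hδ.1 hδ.2
      · have := (planted hδ θ₀).rewardLaw_prob a x
        have h := RelEntropyLE.refl ((planted hδ θ₀).rewardLaw a x)
        simpa [planted, hθ₀, ha, Ne.symm ha] using h
    · have := (planted hδ θ₀).rewardLaw_prob a x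
      have h := RelEntropyLE.refl ((planted hδ θ₀).rewardLaw a x)
      simpa [planted, hθ₀, hx] using h
  have key := ((isStatic_planted hδ θ₀).relEntropyLE_policyDist (diagonalLaw S n) L
    (isStatic_planted hδ _) hd hβ0 hβ1 k).integral_le
      (f := fun π => if π (fun _ => s) = θ s then 1 else 0) Measurable.of_discrete
      (fun π => by split <;> norm_num) (fun π => by split <;> norm_num)
  refine key.trans_eq ?_
  unfold choiceProb
  congr 2
  refine Finset.sum_congr rfl fun j _ => ?_
  rw [← integral_const_mul]
  congr 1
  funext π
  rw [integral_diagonalLaw, Finset.sum_eq_single s (fun x _ hx => by simp [hx]) (by simp)]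
  have : 1 - β ≠ 0 := by linarith
  by_cases h : π (fun _ => s) = θ s
  · simp [h]
    field_simp
  · simp [h]

/-- Resample `θ s` with the other coordinates fixed: the reference model stays the same, and its
choice probabilities sum to 1 over the arms. This produces the factor `1 / n` in both terms. -/
theorem sum_choiceProb_le (hβ0 : 0 ≤ β) (hβ1 : β < 1) (hn : 0 < n) (k : ℕ) (s : Fin S) :
    ∑ θ : Fin S → Fin n, choiceProb hδ β L (some ∘ θ) k s (θ s) ≤
      n ^ S * ((2 * Real.log 2 + 2 * (k * (32 / 15 * δ ^ 2 / ((1 - β) * S)))) / n) := by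
  have hn' : (0 : ℝ) < n := Nat.cast_pos.2 hn
  have hsum (θ : Fin S → Fin n) :
      ∑ a, choiceProb hδ β L (some ∘ Function.update θ s a) k s (Function.update θ s a s) ≤
        2 * Real.log 2 + 2 * (k * (32 / 15 * δ ^ 2 / ((1 - β) * S))) := by
    have hupd (a : Fin n) : Function.update (some ∘ Function.update θ s a) s none =
        Function.update (some ∘ θ) s none := by
      funext x
      by_cases hx : x = s <;> simp [hx]
    refine (Finset.sum_le_sum fun a _ => choiceProb_le hδ L hβ0 hβ1 _ k s).trans_eq ?_
    simp only [hupd, Function.update_self]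
    rw [Finset.sum_add_distrib, ← Finset.mul_sum, ← Finset.mul_sum, Finset.sum_comm,
      sum_choiceProb hδ L hβ0 hβ1]
    simp only [← Finset.mul_sum, sum_choiceProb hδ L hβ0 hβ1]
    simp [mul_comm]
  have := card_mul_sum_eq_sum_update s
    fun θ : Fin S → Fin n => choiceProb hδ β L (some ∘ θ) k s (θ s)
  have hle := Finset.sum_le_sum fun θ (_ : θ ∈ Finset.univ) => hsum θ
  rw [← this] at hle
  simp only [Finset.sum_const, Finset.card_univ, Fintype.card_fun, Fintype.card_fin,
    nsmul_eq_mul, Nat.cast_pow] at hle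
  rw [← mul_div_assoc, le_div_iff₀ hn']
  linarith

theorem expectedRegret_planted (hβ0 : 0 ≤ β) (hβ1 : β < 1) (θ : Fin S → Fin n) (K : ℕ) :
    (planted hδ (some ∘ θ)).expectedRegret β (diagonalLaw S n) L K =
      δ / ((1 - β) * S) * ∑ k ∈ Finset.range K, ∑ s,
        (1 - choiceProb hδ β L (some ∘ θ) k s (θ s)) := by
  rw [expectedRegret_eq_sum _ _ _ hβ0 hβ1, Finset.mul_sum]
  refine Finset.sum_congr rfl fun k _ => ?_
  have := (planted hδ (some ∘ θ)).isProbabilityMeasure_policyDist (diagonalLaw S n) L hβ0 hβ1 k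
  simp only [integral_diagonalLaw, optValue_sub_value_planted hδ hβ0 hβ1]
  rw [integral_div, integral_finsetSum _ fun s _ => .of_finite, Finset.mul_sum, Finset.sum_div]
  refine Finset.sum_congr rfl fun s _ => ?_
  rw [integral_const_mul, integral_sub .of_finite .of_finite, integral_const, probReal_univ,
    one_smul, choiceProb]
  rw [← div_div]
  ring

theorem le_bayesRegret (hβ0 : 0 ≤ β) (hβ1 : β < 1) (hn : 0 < n) (K : ℕ) :
    δ * K / (1 - β) * (1 - (2 * Real.log 2 + 2 * (K * (32 / 15 * δ ^ 2 / ((1 - β) * S)))) / n) ≤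
      bayesRegret β (diagonalLaw S n) (plantedPrior hδ S n) L K := by
  have hn' : (0 : ℝ) < n := Nat.cast_pos.2 hn
  have hS' : (0 : ℝ) < S := Nat.cast_pos.2 (NeZero.pos S)
  have hβ : 0 < 1 - β := by linarith
  set c := (2 * Real.log 2 + 2 * (K * (32 / 15 * δ ^ 2 / ((1 - β) * S)))) / n with hc
  have hsum : ∑ k ∈ Finset.range K, ∑ s : Fin S, (n : ℝ) ^ S * (1 - c) ≤
      ∑ k ∈ Finset.range K, ∑ s : Fin S,
        ∑ θ : Fin S → Fin n, (1 - choiceProb hδ β L (some ∘ θ) k s (θ s)) := by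
    refine Finset.sum_le_sum fun k hk => Finset.sum_le_sum fun s _ => ?_
    have h1 := sum_choiceProb_le hδ L hβ0 hβ1 hn k s
    have hkK : (k : ℝ) ≤ K := Nat.cast_le.2 (Finset.mem_range.1 hk).le
    have h2 : (2 * Real.log 2 + 2 * (k * (32 / 15 * δ ^ 2 / ((1 - β) * S)))) / n ≤ c := by
      rw [hc]
      gcongr
    have h3 := h1.trans (mul_le_mul_of_nonneg_left h2 (pow_nonneg hn'.le S))
    rw [Finset.sum_sub_distrib]
    simp only [Finset.sum_const, Finset.card_univ, Fintype.card_fun, Fintype.card_fin,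
      nsmul_eq_mul, Nat.cast_pow, mul_one]
    linarith
  rw [bayesRegret, integral_plantedPrior, le_div_iff₀ (by positivity)]
  simp only [expectedRegret_planted hδ L hβ0 hβ1, ← Finset.mul_sum]
  rw [Finset.sum_comm]
  simp only [Finset.sum_comm (s := (Finset.univ : Finset (Fin S → Fin n)))]
  refine le_trans (le_of_eq ?_) (mul_le_mul_of_nonneg_left hsum
    (div_nonneg hδ.1 (mul_pos hβ hS').le))
  simp only [Finset.sum_const, Finset.card_univ, Finset.card_range, Fintype.card_fin, nsmul_eq_mul]
  field_simp

end MarkovianBandit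

/-! ### Choice of the gap and conclusion -/

theorem theorem2 (S n K : ℕ) (β : ℝ) (hS : 1 ≤ S) (hn : 2 ≤ n) (hβ0 : 0 ≤ β) (hβ1 : β < 1)
    (hK : 16 * S ≤ K) :
    ∃ (ρ : PMF (GlobalState S n)) (φ : Measure (MarkovianBandit S n)), IsProbabilityMeasure φ ∧
      ∀ L : LearningAlgorithm S n,
        1 / 60 * min (Real.sqrt ((S : ℝ) * n * K / (1 - β))) ((K : ℝ) / (1 - β)) ≤
          bayesRegret β ρ φ L K := by
  have : NeZero S := ⟨by omega⟩
  have hβ : 0 < 1 - β := by linarith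
  have hS' : (0 : ℝ) < S := Nat.cast_pos.2 (by omega)
  have hn' : (2 : ℝ) ≤ n := by exact_mod_cast hn
  have hK' : (0 : ℝ) < K := Nat.cast_pos.2 (by omega)
  set q : ℝ := S * n * (1 - β) / K with hq
  have hq0 : 0 < q := by positivity
  -- The scale `√q` keeps the information term bounded, and the cap at `1/8` keeps the Bernoulli
  -- estimate valid. The two cases of this minimum are those of the claimed bound.
  set δ : ℝ := 1 / 8 * min √q 1 with hδdef
  have hδ : δ ∈ Set.Icc (0 : ℝ) (1 / 8) := by
    refine ⟨by positivity, ?_⟩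
    have := min_le_right √q 1
    rw [hδdef]
    linarith
  refine ⟨diagonalLaw S n, MarkovianBandit.plantedPrior hδ S n,
    MarkovianBandit.isProbabilityMeasure_plantedPrior hδ (by omega), fun L => ?_⟩
  refine le_trans ?_ (MarkovianBandit.le_bayesRegret hδ L hβ0 hβ1 (by omega) K)
  have hmin : min (√((S : ℝ) * n * K / (1 - β))) ((K : ℝ) / (1 - β)) =
      8 * δ * (K / (1 - β)) := by
    have hKN : 0 ≤ (K : ℝ) / (1 - β) := by positivity
    have hsq : √((S : ℝ) * n * K / (1 - β)) = √q * (K / (1 - β)) := by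
      rw [← Real.sqrt_sq hKN]
      rw [← Real.sqrt_mul hq0.le, hq]
      congr 1
      field_simp
    rw [hsq, hδdef, show 8 * (1 / 8 * min √q 1) = min √q 1 by ring, min_mul_of_nonneg _ _ hKN,
      one_mul]
  have hδq : δ ^ 2 ≤ q / 64 := by
    have h1 : δ ≤ 1 / 8 * √q := mul_le_mul_of_nonneg_left (min_le_left _ _) (by norm_num)
    calc δ ^ 2 ≤ (1 / 8 * √q) ^ 2 := pow_le_pow_left₀ hδ.1 h1 2
      _ = q / 64 := by
        rw [mul_pow, Real.sq_sqrt hq0.le]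
        ring
  have hinfo : 2 * (K * (32 / 15 * δ ^ 2 / ((1 - β) * S))) / n ≤ 1 / 15 := by
    calc 2 * (K * (32 / 15 * δ ^ 2 / ((1 - β) * S))) / n
        ≤ 2 * (K * (32 / 15 * (q / 64) / ((1 - β) * S))) / n := by gcongr
      _ = 1 / 15 := by
        rw [hq]
        field_simp
        norm_num
  have hlog : 2 * Real.log 2 / n ≤ 0.7 := by
    rw [div_le_iff₀ (by linarith)]
    linarith [Real.log_two_lt_d9]
  rw [hmin, add_div, mul_div_assoc]
  have hnn : 0 ≤ δ * (K / (1 - β)) := mul_nonneg hδ.1 (by positivity)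
  -- The probability of a miss is at least `1 - 0.7 - 1/15 = 7/30`, while `8/60 = 4/30` is needed.
  nlinarith

end
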